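/- A convex subset $Q$ of a (real, Hausdorff) topological vector space is called *locally nonconical* (LNC) if for all $x, x' \in Q$ and every net $(x_t)$ in $Q$ converging to $x$, the points $x_t + (x'-x)/2$ eventually lie in $Q$; equivalently, for all $x, x' \in Q$ there is a relative neighborhood $U$ of $x$ in $Q$ with $U + (x'-x)/2 \subset Q$. Let $F$ be a finite-dimensional real Hausdorff topological vector space (i.e. $F \cong \mathbf{R}^m$). (1) Every zonoid in $F$ is LNC (in particular convex). That is, let $\nu$ be a countably additive $F$-valued measure on a $\sigma$-algebra $\Sigma$ which is nonatomic: there is no $A \in \Sigma$ with $\nu(A) \neq 0$ such that $\nu(B) \in \{0, \nu(A)\}$ for all $B \in \Sigma$ with $B \subset A$. Then the range $\{\nu(A) : A \in \Sigma\}$ is LNC. (2) More generally, let $K$ be a compact, strictly convex subset of $\mathbf{R}^n$ (for any two distinct points of $K$, the open segment between them lies in the interior of $K$), let $(\Omega, \mu)$ be a $\sigma$-finite measure space, and let $Q = L^\infty(\Omega; K)$ be the set of those $f \in L^\infty(\Omega; \mathbf{R}^n)$ with $f(\omega) \in K$ for almost every $\omega$. Let $T : L^\infty(\Omega; \mathbf{R}^n)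 \to F$ be a linear map that is continuous for the weak* topology of $L^\infty(\Omega; \mathbf{R}^n) = L^1(\Omega; \mathbf{R}^n)^*$. Then $T(Q)$ is LNC. -/

import Mathlib

open MeasureTheory
open scoped ENNReal Topology

noncomputable section

/-- A set `Q` in a real topological vector space is locally nonconical if it is convex and, for all
`x, x' ∈ Q`, the points `y + (x' - x) / 2` lie in `Q` for all `y ∈ Q` close enough to `x`
(that is, eventually along every net in `Q` which converges to `x`). -/
def LocallyNonconical {F : Type*} [AddCommGroup F] [Module ℝ F] [TopologicalSpace F]
    (Q : Set F) : Prop :=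
  Convex ℝ Q ∧
    ∀ x ∈ Q, ∀ x' ∈ Q, ∀ᶠ y in 𝓝[Q] x, y + (1 / 2 : ℝ) • (x' - x) ∈ Q

/-- An atom of a vector measure `ν`: a measurable set `A` with `ν A ≠ 0`, every measurable
subset of which has measure `0` or `ν A`. -/
def IsVectorAtom {Ω F : Type*} [MeasurableSpace Ω] [AddCommGroup F] [TopologicalSpace F]
    (ν : VectorMeasure Ω F) (A : Set Ω) : Prop :=
  MeasurableSet A ∧ ν A ≠ 0 ∧ ∀ B, B ⊆ A → MeasurableSet B → ν B = 0 ∨ ν B = ν A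

/-- A vector measure is nonatomic if it has no atoms. -/
def IsNonatomic {Ω F : Type*} [MeasurableSpace Ω] [AddCommGroup F] [TopologicalSpace F]
    (ν : VectorMeasure Ω F) : Prop :=
  ∀ A, ¬ IsVectorAtom ν A

/-- The range of a vector measure; a zonoid is the range of a nonatomic one with values in a
finite-dimensional space. -/
def vectorMeasureRange {Ω F : Type*} [MeasurableSpace Ω] [AddCommGroup F] [TopologicalSpace F]
    (ν : VectorMeasure Ω F) : Set F :=
  {y | ∃ A, MeasurableSet A ∧ ν A = y}

/-- The set `L^∞(Ω; K)` of those elements of `L^∞(Ω; ℝⁿ)` whose values are in `K` almost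
everywhere. -/
def LinftyInto {Ω : Type*} [MeasurableSpace Ω] (μ : Measure Ω) {n : ℕ}
    (K : Set (EuclideanSpace ℝ (Fin n))) : Set (Lp (EuclideanSpace ℝ (Fin n)) ∞ μ) :=
  {f | ∀ᵐ ω ∂μ, f ω ∈ K}

/-- The weak* topology of `L^∞(Ω; ℝⁿ)` as the dual of `L^1(Ω; ℝⁿ)`: the coarsest topology for
which `f ↦ ∫ ⟪g, f⟫ dμ` is continuous for every `g` in `L^1(Ω; ℝⁿ)`. -/
def weakStarTopology {Ω : Type*} [MeasurableSpace Ω] (μ : Measure Ω) (n : ℕ) :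
    TopologicalSpace (Lp (EuclideanSpace ℝ (Fin n)) ∞ μ) :=
  ⨅ g : Lp (EuclideanSpace ℝ (Fin n)) 1 μ,
    TopologicalSpace.induced (fun f => ∫ ω, inner ℝ (g ω) (f ω) ∂μ) inferInstance

end

noncomputable section

open Filter Set

/-! ### Maximizers of linear functionals on a compact strictly convex set. -/

section Argmax

variable {E : Type*} [NormedAddCommGroup E] [NormedSpace ℝ E] {K : Set E}

/-! Both statements concern the set Z of integrals ∫ g(ω) f(ω) dμ, where g is integrable with values
in Hom(E, V) and f ranges over the measurable functions into a compact strictly convex K. That Z is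
LNC is proved by induction on dim V (`locallyNonconical_selectionIntegrals`). If Z has empty
interior, it lies in a translate of a hyperplane, and projecting lowers the dimension. Otherwise let
x, x' ∈ Z. If their midpoint is interior, nothing is left to do. If not, a functional ℓ ≠ 0 supports
Z at the midpoint, hence is maximal on Z at both x and x'. Put A = {ℓ ∘ g = 0}. Off A, strict
convexity makes the maximizer of ℓ ∘ g(ω) on K unique, so x and x' have the same Aᶜ-part, and the
Aᶜ-parts of near-maximizers converge to it (`tendsto_setIntegral_of_tendsto_isMaxOn`). If y → x in
Z, the A-part of y therefore tends to that of x. Integrals over A lie in ker ℓ, so the induction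
hypothesis allows the A-part of y to be shifted by that of (x' - x)/2; pasting back the Aᶜ-part of y
gives y + (x' - x)/2 ∈ Z.

A weak* continuous map into ℝ^m is integration against L¹ functions, which gives (2). For (1), K =
[0, 1] and g consists of the densities of the coordinates of ν; Lyapunov's theorem identifies Z with
the range of ν. -/

theorem StrictConvex.eq_of_isMaxOn_of_ne_zero (hK : StrictConvex ℝ K) {φ : E →L[ℝ] ℝ} (hφ : φ ≠ 0)
    {p q : E} (hp : p ∈ K) (hq : q ∈ K) (hpm : IsMaxOn φ K p) (hqm : IsMaxOn φ K q) : p = q := by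
  by_contra hne
  have hmid : (1 / 2 : ℝ) • p + (1 / 2 : ℝ) • q ∈ interior K :=
    hK hp hq hne (by norm_num) (by norm_num) (by norm_num)
  have hval : φ ((1 / 2 : ℝ) • p + (1 / 2 : ℝ) • q) = φ p := by
    have : φ p = φ q := le_antisymm (hqm hp) (hpm hq)
    simp only [map_add, map_smul, smul_eq_mul, ← this]
    ring
  have hmax : IsMaxOn φ K ((1 / 2 : ℝ) • p + (1 / 2 : ℝ) • q) := fun y hy => by
    have := hpm hy
    simpa only [mem_ofPred_eq, hval] using this
  -- A linear functional with an interior maximum has zero derivative, so it is zero.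
  have h0 := (hmax.isLocalMax (mem_interior_iff_mem_nhds.1 hmid)).fderiv_eq_zero
  exact hφ (by simpa using h0)

/-- In a compact strictly convex set, maximizing families of a nonzero functional converge to the
maximizer. -/
theorem StrictConvex.tendsto_of_tendsto_isMaxOn (hK : StrictConvex ℝ K) (hc : IsCompact K)
    {φ : E →L[ℝ] ℝ} (hφ : φ ≠ 0) {q : E} (hq : q ∈ K) (hqm : IsMaxOn φ K q)
    {ι : Type*} {l : Filter ι} {p : ι → E} (hp : ∀ᶠ i in l, p i ∈ K)
    (ht : Tendsto (fun i => φ (p i)) l (𝓝 (φ q))) : Tendsto p l (𝓝 q) := by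
  refine hc.tendsto_nhds_of_unique_mapClusterPt hp fun y hy hcl => ?_
  have h1 : MapClusterPt (φ y) l (fun i => φ (p i)) :=
    hcl.continuousAt_comp φ.continuous.continuousAt
  have h2 : φ y = φ q := by
    by_contra hne
    have := h1.neBot
    exact this.ne (((disjoint_nhds_nhds.2 hne).mono_right ht).eq_bot)
  refine hK.eq_of_isMaxOn_of_ne_zero hφ hy hq (fun z hz => ?_) hqm
  have := hqm hz
  simpa only [mem_ofPred_eq, h2] using this

/-- A compact strictly convex set has a measurable choice of maximizers of functionals. -/
theorem StrictConvex.exists_measurable_isMaxOn [MeasurableSpace E] [BorelSpace E]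
    (hK : StrictConvex ℝ K) (hc : IsCompact K) (hne : K.Nonempty) :
    ∃ a : (E →L[ℝ] ℝ) → E, Measurable a ∧ ∀ φ, a φ ∈ K ∧ IsMaxOn φ K (a φ) := by
  choose a haK ham using fun φ : E →L[ℝ] ℝ => hc.exists_isMaxOn hne φ.continuous.continuousOn
  refine ⟨a, ?_, fun φ => ⟨haK φ, ham φ⟩⟩
  obtain ⟨R, hR⟩ := hc.isBounded.exists_norm_le
  -- Every point of K maximizes the zero functional, so continuity can fail there; one exceptional
  -- point does not affect measurability.
  have hcont : ContinuousOn a {0}ᶜ := by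
    intro φ hφ
    refine ContinuousAt.continuousWithinAt ?_
    refine hK.tendsto_of_tendsto_isMaxOn hc hφ (haK φ) (ham φ) (Eventually.of_forall haK) ?_
    have hlow : Tendsto (fun ψ : E →L[ℝ] ℝ => ψ (a φ) - ‖ψ - φ‖ * R) (𝓝 φ) (𝓝 (φ (a φ))) := by
      have : Continuous (fun ψ : E →L[ℝ] ℝ => ψ (a φ) - ‖ψ - φ‖ * R) := by fun_prop
      simpa using this.tendsto φ
    refine tendsto_of_tendsto_of_tendsto_of_le_of_le hlow tendsto_const_nhds (fun ψ => ?_)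
      fun ψ => ham φ (haK ψ)
    have h1 : ψ (a φ) ≤ ψ (a ψ) := ham ψ (haK φ)
    have h2 : ψ (a ψ) - φ (a ψ) ≤ ‖ψ - φ‖ * R :=
      calc ψ (a ψ) - φ (a ψ) = (ψ - φ) (a ψ) := rfl
        _ ≤ ‖(ψ - φ) (a ψ)‖ := Real.le_norm_self _
        _ ≤ ‖ψ - φ‖ * ‖a ψ‖ := (ψ - φ).le_opNorm _
        _ ≤ ‖ψ - φ‖ * R := by gcongr; exact hR _ (haK ψ)
    change ψ (a φ) - ‖ψ - φ‖ * R ≤ φ (a ψ)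
    linarith
  classical
  have hpw := hcont.measurable_piecewise (g := fun _ => a 0) continuousOn_const
    (isClosed_singleton.isOpen_compl.measurableSet)
  convert hpw using 1
  ext1 φ
  by_cases h : φ = 0 <;> simp [h]

end Argmax

/-! ### Integrals of selections and convergence of maximizing sequences. -/

/-- The measurable functions with values in `K`, up to null sets. -/
def measurableSelections {Ω E : Type*} [MeasurableSpace Ω] [NormedAddCommGroup E]
    (μ : Measure Ω) (K : Set E) : Set (Ω → E) :=
  {f | AEStronglyMeasurable f μ ∧ ∀ᵐ ω ∂μ, f ω ∈ K}

/-- The set of the integrals `∫ g(ω) f(ω) dμ` where `f` is a measurable function with values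
in `K`. -/
def selectionIntegrals {Ω E V : Type*} [MeasurableSpace Ω] [NormedAddCommGroup E]
    [NormedSpace ℝ E] [NormedAddCommGroup V] [NormedSpace ℝ V]
    (μ : Measure Ω) (g : Ω → E →L[ℝ] V) (K : Set E) : Set V :=
  (fun f : Ω → E => ∫ ω, g ω (f ω) ∂μ) '' measurableSelections μ K

theorem measurableSelections_mono {Ω E : Type*} [MeasurableSpace Ω] [NormedAddCommGroup E]
    {K : Set E} {μ ν : Measure Ω} (h : ν ≤ μ) :
    measurableSelections μ K ⊆ measurableSelections ν K :=
  fun _ hf => ⟨hf.1.mono_measure h, Measure.absolutelyContinuous_of_le h |>.ae_le hf.2⟩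

section Selections

variable {Ω E V : Type*} [MeasurableSpace Ω] {μ : Measure Ω}
  [NormedAddCommGroup E] [NormedSpace ℝ E] [NormedAddCommGroup V] [NormedSpace ℝ V]
  {g : Ω → E →L[ℝ] V} {K : Set E}

theorem Convex.measurableSelections (hK : Convex ℝ K) : Convex ℝ (measurableSelections μ K) := by
  intro f hf f' hf' a b ha hb hab
  refine ⟨(hf.1.const_smul a).add (hf'.1.const_smul b), ?_⟩
  filter_upwards [hf.2, hf'.2] with ω h h'
  exact hK h h' ha hb hab

theorem integrable_apply_selection (hg : Integrable g μ) (hK : Bornology.IsBounded K)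
    {f : Ω → E} (hf : f ∈ measurableSelections μ K) : Integrable (fun ω => g ω (f ω)) μ := by
  obtain ⟨R, hR⟩ := hK.exists_norm_le
  refine (hg.norm.mul_const R).mono'
    (ContinuousLinearMap.aestronglyMeasurable_comp₂ (ContinuousLinearMap.id ℝ (E →L[ℝ] V))
      hg.aestronglyMeasurable hf.1) ?_
  filter_upwards [hf.2] with ω hω
  exact ((g ω).le_opNorm _).trans (by gcongr; exact hR _ hω)

theorem convex_selectionIntegrals (hg : Integrable g μ) (hb : Bornology.IsBounded K)
    (hK : Convex ℝ K) : Convex ℝ (selectionIntegrals μ g K) := by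
  rintro _ ⟨f, hf, rfl⟩ _ ⟨f', hf', rfl⟩ a b ha hb' hab
  refine ⟨a • f + b • f', hK.measurableSelections hf hf' ha hb' hab, ?_⟩
  have h1 := integrable_apply_selection hg hb hf
  have h2 := integrable_apply_selection hg hb hf'
  simp only [Pi.add_apply, Pi.smul_apply, map_add, map_smul]
  exact (integral_add (h1.smul a) (h2.smul b)).trans (by simp only [Pi.smul_apply, integral_smul])

theorem selectionIntegrals_add_mem (hg : Integrable g μ) (hb : Bornology.IsBounded K)
    {A : Set Ω} (hA : MeasurableSet A) {x y : V}
    (hx : x ∈ selectionIntegrals (μ.restrict A) g K)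
    (hy : y ∈ selectionIntegrals (μ.restrict Aᶜ) g K) : x + y ∈ selectionIntegrals μ g K := by
  classical
  obtain ⟨f, hf, rfl⟩ := hx
  obtain ⟨f', hf', rfl⟩ := hy
  have hsel : A.piecewise f f' ∈ measurableSelections μ K := by
    refine ⟨AEStronglyMeasurable.piecewise hA hf.1 hf'.1, ?_⟩
    filter_upwards [(ae_restrict_iff' hA).1 hf.2, (ae_restrict_iff' hA.compl).1 hf'.2] with ω h h'
    by_cases hω : ω ∈ A
    · simpa [hω] using h hω
    · simpa [hω] using h' hω
  refine ⟨_, hsel, ?_⟩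
  simp only
  rw [← integral_add_compl hA (integrable_apply_selection hg hb hsel)]
  congr 1
  · exact setIntegral_congr_fun hA fun ω hω => by simp [hω]
  · exact setIntegral_congr_fun hA.compl fun ω hω => by
      have : ω ∉ A := hω
      simp [this]

theorem comp_selectionIntegrals {W : Type*} [NormedAddCommGroup W] [NormedSpace ℝ W]
    [CompleteSpace V] [CompleteSpace W] (hg : Integrable g μ) (hb : Bornology.IsBounded K)
    (L : V →L[ℝ] W) :
    selectionIntegrals μ (fun ω => L.comp (g ω)) K = L '' selectionIntegrals μ g K := by
  rw [selectionIntegrals, selectionIntegrals, image_image]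
  refine image_congr fun f hf => ?_
  simpa using L.integral_comp_comm (integrable_apply_selection hg hb hf)

/-- Where `ℓ ∘ g ≠ 0`, the integrals of a sequence of selections converge as soon as `ℓ` of the
full integrals converges to its maximum. -/
theorem tendsto_setIntegral_of_tendsto_isMaxOn [CompleteSpace V] (hg : Integrable g μ)
    (hc : IsCompact K) (hK : StrictConvex ℝ K) (ℓ : V →L[ℝ] ℝ)
    (hA : MeasurableSet {ω | ℓ.comp (g ω) = 0})
    {p : Ω → E} (hp : p ∈ measurableSelections μ K) (hpm : ∀ ω, IsMaxOn (ℓ.comp (g ω)) K (p ω))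
    {f : ℕ → Ω → E} (hf : ∀ k, f k ∈ measurableSelections μ K)
    (ht : Tendsto (fun k => ℓ (∫ ω, g ω (f k ω) ∂μ)) atTop (𝓝 (ℓ (∫ ω, g ω (p ω) ∂μ)))) :
    Tendsto (fun k => ∫ ω in {ω | ℓ.comp (g ω) = 0}ᶜ, g ω (f k ω) ∂μ) atTop
      (𝓝 (∫ ω in {ω | ℓ.comp (g ω) = 0}ᶜ, g ω (p ω) ∂μ)) := by
  have hb := hc.isBounded
  have hip := integrable_apply_selection hg hb hp
  have hif := fun k => integrable_apply_selection hg hb (hf k)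
  -- The pointwise defect from the maximum is nonnegative with integral tending to 0, so it tends to
  -- 0 in L¹ and hence in measure.
  set u : ℕ → Ω → ℝ := fun k ω => ℓ (g ω (p ω)) - ℓ (g ω (f k ω)) with hu
  have hui : ∀ k, Integrable (u k) μ := fun k =>
    (ℓ.integrable_comp hip).sub (ℓ.integrable_comp (hif k))
  have hu0 : ∀ k, 0 ≤ᵐ[μ] u k := fun k => by
    filter_upwards [(hf k).2] with ω hω
    exact sub_nonneg.2 (hpm ω hω)
  have hulim : Tendsto (fun k => ∫ ω, u k ω ∂μ) atTop (𝓝 0) := by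
    have h1 : ∀ k, ∫ ω, u k ω ∂μ = ℓ (∫ ω, g ω (p ω) ∂μ) - ℓ (∫ ω, g ω (f k ω) ∂μ) := fun k => by
      rw [hu, integral_sub (ℓ.integrable_comp hip) (ℓ.integrable_comp (hif k)),
        ℓ.integral_comp_comm hip, ℓ.integral_comp_comm (hif k)]
    simp only [h1]
    simpa using ht.const_sub (ℓ (∫ ω, g ω (p ω) ∂μ))
  have hmeas : TendstoInMeasure μ u atTop 0 := by
    refine tendstoInMeasure_of_tendsto_eLpNorm (p := 1) one_ne_zero
      (fun k => (hui k).aestronglyMeasurable) aestronglyMeasurable_zero ?_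
    have h1 : ∀ k, eLpNorm (u k - 0) 1 μ = ENNReal.ofReal (∫ ω, u k ω ∂μ) := fun k => by
      rw [sub_zero, eLpNorm_one_eq_lintegral_enorm,
        ← ofReal_integral_norm_eq_lintegral_enorm (hui k)]
      congr 1
      refine integral_congr_ae ?_
      filter_upwards [hu0 k] with ω hω
      exact Real.norm_of_nonneg hω
    simp only [h1]
    simpa using ENNReal.tendsto_ofReal hulim
  obtain ⟨R, hR⟩ := hb.exists_norm_le
  -- Convergence in measure gives a.e. convergence only along subsequences, which suffices for the
  -- limit of the integrals.
  refine tendsto_of_subseq_tendsto fun ns hns => ?_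
  obtain ⟨ms, -, hms⟩ := TendstoInMeasure.exists_seq_tendsto_ae fun ε hε => (hmeas ε hε).comp hns
  refine ⟨ms, ?_⟩
  refine tendsto_integral_of_dominated_convergence (fun ω => ‖g ω‖ * R)
    (fun k => (hif _).aestronglyMeasurable.restrict) (hg.norm.mul_const R).restrict
    (fun k => ae_restrict_of_ae ?_) ?_
  · filter_upwards [(hf (ns (ms k))).2] with ω hω
    exact ((g ω).le_opNorm _).trans (by gcongr; exact hR _ hω)
  · rw [ae_restrict_iff' hA.compl]
    filter_upwards [hms, hp.2, ae_all_iff.2 fun k => (hf k).2] with ω h1 h2 h3 h4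
    refine ((g ω).continuous.tendsto _).comp (hK.tendsto_of_tendsto_isMaxOn hc h4 h2 (hpm ω)
      (Eventually.of_forall fun k => h3 _) ?_)
    have := h1.const_sub (ℓ (g ω (p ω)))
    simpa [hu] using this

end Selections

/-! ### Passing to lower dimension. -/

/-- Local nonconicality can be checked on the image under a continuous linear map which is
injective on the affine span. -/
theorem LocallyNonconical.of_image {V W : Type*} [AddCommGroup V] [Module ℝ V] [TopologicalSpace V]
    [AddCommGroup W] [Module ℝ W] [TopologicalSpace W] {Z : Set V} (hZ : Convex ℝ Z)
    (L : V →L[ℝ] W) (hL : InjOn L (affineSpan ℝ Z)) (h : LocallyNonconical (L '' Z)) :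
    LocallyNonconical Z := by
  refine ⟨hZ, fun x hx x' hx' => ?_⟩
  have ht : Tendsto L (𝓝[Z] x) (𝓝[L '' Z] (L x)) :=
    L.continuous.continuousWithinAt.tendsto_nhdsWithin (mapsTo_image _ _)
  filter_upwards [ht (h.2 _ (mem_image_of_mem _ hx) _ (mem_image_of_mem _ hx')),
    self_mem_nhdsWithin] with y hy hyZ
  obtain ⟨z, hz, hzy⟩ : L y + (1 / 2 : ℝ) • (L x' - L x) ∈ L '' Z := hy
  have hmem : y + (1 / 2 : ℝ) • (x' - x) ∈ affineSpan ℝ Z := by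
    rw [add_comm]
    refine AffineSubspace.vadd_mem_of_mem_direction (Submodule.smul_mem _ _ ?_)
      (subset_affineSpan ℝ Z hyZ)
    exact AffineSubspace.vsub_mem_direction (subset_affineSpan ℝ Z hx') (subset_affineSpan ℝ Z hx)
  have : z = y + (1 / 2 : ℝ) • (x' - x) :=
    hL (subset_affineSpan ℝ Z hz) hmem (by simpa using hzy)
  exact this ▸ hz

theorem Set.Subsingleton.locallyNonconical {V : Type*} [AddCommGroup V] [Module ℝ V]
    [TopologicalSpace V] {Z : Set V} (hZ : Z.Subsingleton) : LocallyNonconical Z := by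
  refine ⟨hZ.convex, fun x hx x' hx' => ?_⟩
  filter_upwards [self_mem_nhdsWithin] with y hy
  rwa [hZ hx' hx, sub_self, smul_zero, add_zero]

/-- The map is v ↦ v - (ℓ v / ℓ e) e, for any e with ℓ e ≠ 0. -/
theorem exists_ker_projection {V : Type*} [NormedAddCommGroup V] [NormedSpace ℝ V]
    {ℓ : V →L[ℝ] ℝ} (hℓ : ℓ ≠ 0) :
    ∃ L : V →L[ℝ] LinearMap.ker ℓ.toLinearMap, ∀ v, ℓ v = 0 → L v = 0 → v = 0 := by
  obtain ⟨e, he⟩ : ∃ e, ℓ e ≠ 0 := by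
    by_contra! h
    exact hℓ (ContinuousLinearMap.ext h)
  refine ⟨(ContinuousLinearMap.id ℝ V - ℓ.smulRight ((ℓ e)⁻¹ • e)).codRestrict _ fun v => ?_,
    fun v hv hLv => ?_⟩
  · simp [he]
  · have := congrArg Subtype.val hLv
    simpa [hv] using this

/-! ### The induction on the dimension. -/

section Main

variable {Ω E : Type*} [MeasurableSpace Ω] [NormedAddCommGroup E] [NormedSpace ℝ E] {K : Set E}

/-- The projection L onto ker ℓ is injective on the affine span, and the image is again a set of
integrals of selections, now with L ∘ g in place of g. -/
theorem locallyNonconical_selectionIntegrals_of_vectorSpan_le_ker {V : Type*}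
    [NormedAddCommGroup V] [NormedSpace ℝ V] [FiniteDimensional ℝ V] {μ : Measure Ω}
    {g : Ω → E →L[ℝ] V} (hg : Integrable g μ) (hb : Bornology.IsBounded K) (hK : Convex ℝ K)
    {ℓ : V →L[ℝ] ℝ} (hℓ : ℓ ≠ 0)
    (hker : vectorSpan ℝ (selectionIntegrals μ g K) ≤ LinearMap.ker ℓ.toLinearMap)
    (ih : ∀ L : V →L[ℝ] LinearMap.ker ℓ.toLinearMap,
      LocallyNonconical (selectionIntegrals μ (fun ω => L.comp (g ω)) K)) :
    LocallyNonconical (selectionIntegrals μ g K) := by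
  obtain ⟨L, hL⟩ := exists_ker_projection hℓ
  refine LocallyNonconical.of_image (convex_selectionIntegrals hg hb hK) L (fun v hv w hw hvw => ?_)
    (comp_selectionIntegrals hg hb L ▸ ih L)
  have hmem : v - w ∈ vectorSpan ℝ (selectionIntegrals μ g K) := by
    rw [← direction_affineSpan]
    exact AffineSubspace.vsub_mem_direction hv hw
  exact sub_eq_zero.1 (hL _ (hker hmem) (by rw [map_sub, hvw, sub_self]))

/-- The integrals `∫ g(ω) f(ω) dμ` of the measurable functions `f` with values in a compact strictly
convex set form a locally nonconical set. -/
theorem locallyNonconical_selectionIntegrals [MeasurableSpace E] [BorelSpace E]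
    [SecondCountableTopology E] (hc : IsCompact K) (hK : StrictConvex ℝ K) {V : Type*}
    [NormedAddCommGroup V] [NormedSpace ℝ V] [FiniteDimensional ℝ V] {μ : Measure Ω}
    {g : Ω → E →L[ℝ] V} (hgm : StronglyMeasurable g) (hg : Integrable g μ) :
    LocallyNonconical (selectionIntegrals μ g K) := by
  induction hd : Module.finrank ℝ V using Nat.strong_induction_on generalizing V μ with
  | _ d ih =>
  have hb := hc.isBounded
  have hconv := convex_selectionIntegrals hg hb hK.convex
  rcases K.eq_empty_or_nonempty with hKe | hKne
  · refine Set.Subsingleton.locallyNonconical ?_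
    have h0 : ∀ z ∈ selectionIntegrals μ g K, z = 0 := by
      rintro _ ⟨f, hf, rfl⟩
      have hμ : μ = 0 := by simpa [hKe] using hf.2
      simp [hμ]
    exact fun z hz z' hz' => (h0 z hz).trans (h0 z' hz').symm
  obtain ⟨a, ham, haK⟩ := hK.exists_measurable_isMaxOn hc hKne
  have hZne : (selectionIntegrals μ g K).Nonempty :=
    ⟨_, fun _ => a 0, ⟨aestronglyMeasurable_const, Eventually.of_forall fun _ => (haK 0).1⟩, rfl⟩
  -- The measure is left free because this is used both for μ and for its restriction to A.
  have hred : ∀ (ℓ : V →L[ℝ] ℝ), ℓ ≠ 0 → ∀ ν : Measure Ω, Integrable g ν →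
      vectorSpan ℝ (selectionIntegrals ν g K) ≤ LinearMap.ker ℓ.toLinearMap →
      LocallyNonconical (selectionIntegrals ν g K) := by
    intro ℓ hℓ ν hν hker
    refine locallyNonconical_selectionIntegrals_of_vectorSpan_le_ker hν hb hK.convex hℓ hker
      fun L => ih (Module.finrank ℝ (LinearMap.ker ℓ.toLinearMap)) ?_ ?_ ?_ rfl
    · rw [← hd]
      refine Submodule.finrank_lt fun h => hℓ ?_
      exact ContinuousLinearMap.coe_injective (LinearMap.ker_eq_top.1 h)
    · exact ((ContinuousLinearMap.compL ℝ E V _ L).continuous).comp_stronglyMeasurable hgm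
    · exact (ContinuousLinearMap.compL ℝ E V _ L).integrable_comp hν
  by_cases hint : (interior (selectionIntegrals μ g K)).Nonempty
  swap
  · rw [hconv.interior_nonempty_iff_affineSpan_eq_top,
      AffineSubspace.affineSpan_eq_top_iff_vectorSpan_eq_top_of_nonempty ℝ V V hZne] at hint
    obtain ⟨ℓ, hℓ, hker⟩ := Submodule.exists_le_ker_of_lt_top _ (lt_top_iff_ne_top.2 hint)
    refine hred ℓ.toContinuousLinearMap (fun h => hℓ ?_) μ hg hker
    ext v
    simpa using DFunLike.congr_fun h v
  refine ⟨hconv, fun x hx x' hx' => ?_⟩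
  by_cases hw : x + (1 / 2 : ℝ) • (x' - x) ∈ interior (selectionIntegrals μ g K)
  · have hcont : ContinuousAt (fun y => y + (1 / 2 : ℝ) • (x' - x)) x := by fun_prop
    filter_upwards [nhdsWithin_le_nhds (hcont (isOpen_interior.mem_nhds hw))] with y hy
    exact interior_subset hy
  obtain ⟨ℓ, hℓ, hmax⟩ := geometric_hahn_banach_of_nonempty_interior_point hconv hw hint
  have hval : ℓ (x + (1 / 2 : ℝ) • (x' - x)) = (ℓ x + ℓ x') / 2 := by
    simp only [map_add, map_smul, map_sub, smul_eq_mul]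
    ring
  rw [hval] at hmax
  -- The mean of ℓ x and ℓ x' bounds each of them.
  have hxx' : ℓ x' = ℓ x := by linarith [hmax x hx, hmax x' hx']
  have hmaxx : ∀ z ∈ selectionIntegrals μ g K, ℓ z ≤ ℓ x := fun z hz => by
    linarith [hmax z hz]
  set A : Set Ω := {ω | ℓ.comp (g ω) = 0} with hAdef
  have hcm : StronglyMeasurable fun ω => ℓ.comp (g ω) :=
    ((ContinuousLinearMap.compL ℝ E V ℝ ℓ).continuous).comp_stronglyMeasurable hgm
  have hA : MeasurableSet A := hcm.measurable (measurableSet_singleton 0)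
  have hZA : LocallyNonconical (selectionIntegrals (μ.restrict A) g K) := by
    refine hred ℓ hℓ _ hg.restrict (Submodule.span_le.2 ?_)
    have h0 : ∀ z ∈ selectionIntegrals (μ.restrict A) g K, ℓ z = 0 := by
      rintro _ ⟨f, hf, rfl⟩
      rw [← ℓ.integral_comp_comm (integrable_apply_selection hg.restrict hb hf)]
      refine setIntegral_eq_zero_of_forall_eq_zero fun ω hω => ?_
      exact DFunLike.congr_fun (show ℓ.comp (g ω) = 0 from hω) (f ω)
    rintro _ ⟨z, hz, z', hz', rfl⟩
    simp [h0 z hz, h0 z' hz']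
  obtain ⟨f, hf, rfl⟩ := hx
  obtain ⟨f', hf', rfl⟩ := hx'
  set p : Ω → E := fun ω => a (ℓ.comp (g ω)) with hpdef
  have hp : p ∈ measurableSelections μ K :=
    ⟨(ham.comp hcm.measurable).aestronglyMeasurable, Eventually.of_forall fun ω => (haK _).1⟩
  have hpm : ∀ ω, IsMaxOn (ℓ.comp (g ω)) K (p ω) := fun ω => (haK _).2
  have hple : ∀ q ∈ measurableSelections μ K,
      ℓ (∫ ω, g ω (q ω) ∂μ) ≤ ℓ (∫ ω, g ω (p ω) ∂μ) := fun q hq => by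
    have h1 := integrable_apply_selection hg hb hq
    have h2 := integrable_apply_selection hg hb hp
    rw [← ℓ.integral_comp_comm h1, ← ℓ.integral_comp_comm h2]
    refine integral_mono_ae (ℓ.integrable_comp h1) (ℓ.integrable_comp h2) ?_
    filter_upwards [hq.2] with ω hω
    exact hpm ω hω
  have hpx : ℓ (∫ ω, g ω (p ω) ∂μ) = ℓ (∫ ω, g ω (f ω) ∂μ) :=
    le_antisymm (hmaxx _ ⟨p, hp, rfl⟩) (hple f hf)
  have hsplit : ∀ q ∈ measurableSelections μ K,
      ∫ ω, g ω (q ω) ∂μ = ∫ ω in A, g ω (q ω) ∂μ + ∫ ω in Aᶜ, g ω (q ω) ∂μ := fun q hq =>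
    (integral_add_compl hA (integrable_apply_selection hg hb hq)).symm
  -- Uniqueness on the face is the convergence lemma applied to a constant sequence.
  have hface : ∀ q ∈ measurableSelections μ K,
      ℓ (∫ ω, g ω (q ω) ∂μ) = ℓ (∫ ω, g ω (f ω) ∂μ) →
      ∫ ω in Aᶜ, g ω (q ω) ∂μ = ∫ ω in Aᶜ, g ω (p ω) ∂μ := fun q hq hqv =>
    tendsto_nhds_unique tendsto_const_nhds <|
      tendsto_setIntegral_of_tendsto_isMaxOn hg hc hK ℓ hA hp hpm (f := fun _ => q) (fun _ => hq)
        (by rw [hqv, ← hpx]; exact tendsto_const_nhds)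
  have hmemA : ∀ q ∈ measurableSelections μ K,
      ∫ ω in A, g ω (q ω) ∂μ ∈ selectionIntegrals (μ.restrict A) g K := fun q hq =>
    ⟨q, measurableSelections_mono Measure.restrict_le_self hq, rfl⟩
  rw [eventually_iff_seq_eventually]
  intro y hy
  obtain ⟨hyx, hyZ⟩ := tendsto_nhdsWithin_iff.1 hy
  -- The sequence is only eventually in Z; elsewhere f serves as a default.
  have hch : ∀ k, ∃ q ∈ measurableSelections μ K,
      y k ∈ selectionIntegrals μ g K → ∫ ω, g ω (q ω) ∂μ = y k := fun k => by
    by_cases hk : y k ∈ selectionIntegrals μ g K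
    · obtain ⟨q, hq, hqk⟩ := hk
      exact ⟨q, hq, fun _ => hqk⟩
    · exact ⟨f, hf, fun h => absurd h hk⟩
  choose q hq hqy using hch
  have hqy' : ∀ᶠ k in atTop, ∫ ω, g ω (q k ω) ∂μ = y k := hyZ.mono fun k hk => hqy k hk
  have hqx : Tendsto (fun k => ∫ ω, g ω (q k ω) ∂μ) atTop (𝓝 (∫ ω, g ω (f ω) ∂μ)) :=
    hyx.congr' (hqy'.mono fun k hk => hk.symm)
  have hqc := tendsto_setIntegral_of_tendsto_isMaxOn hg hc hK ℓ hA hp hpm hq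
    (by rw [hpx]; exact (ℓ.continuous.tendsto _).comp hqx)
  have hqA : Tendsto (fun k => ∫ ω in A, g ω (q k ω) ∂μ) atTop
      (𝓝[selectionIntegrals (μ.restrict A) g K] (∫ ω in A, g ω (f ω) ∂μ)) := by
    refine tendsto_nhdsWithin_iff.2 ⟨?_, Eventually.of_forall fun k => hmemA _ (hq k)⟩
    have h := hqx.sub hqc
    rw [← hface f hf rfl, hsplit f hf, add_sub_cancel_right] at h
    refine h.congr fun k => ?_
    rw [hsplit _ (hq k), add_sub_cancel_right]
  filter_upwards [hqy', hqA (hZA.2 _ (hmemA f hf) _ (hmemA f' hf'))] with k hk hkA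
  have hsum := selectionIntegrals_add_mem hg hb hA hkA
    ⟨q k, measurableSelections_mono Measure.restrict_le_self (hq k), rfl⟩
  -- The Aᶜ-parts of x and x' agree, so (x' - x)/2 is carried by A alone.
  convert hsum using 1
  rw [← hk]
  simp only [hsplit _ (hq k), hsplit _ hf, hsplit _ hf', hface f hf rfl, hface f' hf' hxx']
  abel_nf

end Main

/-! ### Passage to coordinates. -/

theorem LocallyNonconical.of_image_equiv {V W : Type*} [AddCommGroup V] [Module ℝ V]
    [TopologicalSpace V] [AddCommGroup W] [Module ℝ W] [TopologicalSpace W] {Z : Set V}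
    (e : V ≃L[ℝ] W) (h : LocallyNonconical (e '' Z)) : LocallyNonconical Z := by
  refine LocallyNonconical.of_image ?_ (e : V →L[ℝ] W) e.injective.injOn h
  have := h.1.linear_preimage (e : V →L[ℝ] W).toLinearMap
  simpa [preimage_image_eq Z e.injective] using this

theorem locallyNonconical_integrals_pi {Ω E ι : Type*} [MeasurableSpace Ω] [Fintype ι]
    [NormedAddCommGroup E] [NormedSpace ℝ E] [MeasurableSpace E] [BorelSpace E]
    [SecondCountableTopology E] {K : Set E} (hc : IsCompact K) (hK : StrictConvex ℝ K)
    {μ : Measure Ω} {c : ι → Ω → E →L[ℝ] ℝ} (hcm : ∀ i, StronglyMeasurable (c i))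
    (hci : ∀ i, Integrable (c i) μ) :
    LocallyNonconical ((fun (f : Ω → E) i => ∫ ω, c i ω (f ω) ∂μ) '' measurableSelections μ K) := by
  classical
  obtain ⟨S, hS⟩ : ∃ S : ι → (E →L[ℝ] ℝ) →L[ℝ] E →L[ℝ] (ι → ℝ),
      ∀ i φ v, S i φ v = Pi.single i (φ v) :=
    ⟨fun i => ContinuousLinearMap.compL ℝ E ℝ (ι → ℝ) (ContinuousLinearMap.single ℝ (fun _ => ℝ) i),
      fun _ _ _ => rfl⟩
  obtain ⟨G, hG⟩ : ∃ G : Ω → E →L[ℝ] (ι → ℝ), G = fun ω => ∑ i, S i (c i ω) := ⟨_, rfl⟩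
  have hGm : StronglyMeasurable G := by
    have h1 : ∀ i, StronglyMeasurable fun ω => S i (c i ω) := fun i =>
      (S i).continuous.comp_stronglyMeasurable (hcm i)
    rw [hG]
    exact Finset.stronglyMeasurable_fun_sum _ fun i _ => h1 i
  have hGi : Integrable G μ := by
    have h1 : ∀ i, Integrable (fun ω => ‖S i (c i ω)‖) μ := fun i =>
      ((S i).integrable_comp (hci i)).norm
    refine Integrable.mono' (integrable_finsetSum Finset.univ fun i _ => h1 i)
      hGm.aestronglyMeasurable (Eventually.of_forall fun ω => ?_)
    rw [hG]
    exact norm_sum_le _ _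
  have hGc : ∀ ω v i, G ω v i = c i ω v := fun ω v i => by
    simp [hG, hS, Finset.sum_apply, Pi.single_apply]
  have hset : (fun (f : Ω → E) i => ∫ ω, c i ω (f ω) ∂μ) '' measurableSelections μ K =
      selectionIntegrals μ G K := by
    refine image_congr fun f hf => ?_
    ext i
    have h := (ContinuousLinearMap.proj (R := ℝ) (φ := fun _ : ι => ℝ) i).integral_comp_comm
      (integrable_apply_selection hGi hc.isBounded hf)
    simpa [hGc] using h
  rw [hset]
  exact locallyNonconical_selectionIntegrals hc hK hGm hGi

/-! ### Weak* continuous images of L^∞(Ω; K). -/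

section WeakStar

variable {Ω : Type*} [MeasurableSpace Ω] {μ : Measure Ω} {n : ℕ}

theorem Lp_top_mem_measurableSelections (f : Lp (EuclideanSpace ℝ (Fin n)) ∞ μ) :
    ⇑f ∈ measurableSelections μ (Metric.closedBall 0 ‖f‖) := by
  refine ⟨Lp.aestronglyMeasurable f, ?_⟩
  have h := ae_le_eLpNormEssSup (f := f) (μ := μ)
  filter_upwards [h] with ω hω
  rw [mem_closedBall_zero_iff, Lp.norm_def, eLpNorm_exponent_top]
  have := ENNReal.toReal_mono (by simpa using (Lp.memLp f).2.ne) hω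
  simpa using this

theorem integrable_innerSL_Lp_one (g : Lp (EuclideanSpace ℝ (Fin n)) 1 μ) :
    Integrable (fun ω => innerSL ℝ (g ω)) μ :=
  (innerSL ℝ (E := EuclideanSpace ℝ (Fin n))).integrable_comp (L1.integrable_coeFn g)

theorem integrable_inner_Lp (g : Lp (EuclideanSpace ℝ (Fin n)) 1 μ)
    (f : Lp (EuclideanSpace ℝ (Fin n)) ∞ μ) : Integrable (fun ω => inner ℝ (g ω) (f ω)) μ :=
  integrable_apply_selection (integrable_innerSL_Lp_one g) Metric.isBounded_closedBall
    (Lp_top_mem_measurableSelections f)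

/-- The functional `f ↦ ∫ ⟪g, f⟫ dμ` on `L^∞` given by an element `g` of `L^1`. -/
def integralInner (g : Lp (EuclideanSpace ℝ (Fin n)) 1 μ) :
    Lp (EuclideanSpace ℝ (Fin n)) ∞ μ →ₗ[ℝ] ℝ where
  toFun f := ∫ ω, inner ℝ (g ω) (f ω) ∂μ
  map_add' f f' := by
    rw [← integral_add (integrable_inner_Lp g f) (integrable_inner_Lp g f')]
    refine integral_congr_ae ?_
    filter_upwards [Lp.coeFn_add f f'] with ω hω
    rw [hω, Pi.add_apply, inner_add_right]
  map_smul' r f := by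
    rw [RingHom.id_apply, smul_eq_mul, ← integral_const_mul]
    refine integral_congr_ae ?_
    filter_upwards [Lp.coeFn_smul r f] with ω hω
    rw [hω, Pi.smul_apply, inner_smul_right_eq_smul, smul_eq_mul]

/-- A functional continuous for the topology induced by a family of functionals is a finite linear
combination of them, and L¹ is closed under linear combinations. -/
theorem exists_integralInner_eq_of_continuous {φ : Lp (EuclideanSpace ℝ (Fin n)) ∞ μ →ₗ[ℝ] ℝ}
    (hφ : Continuous[weakStarTopology μ n, inferInstance] φ) : ∃ g, φ = integralInner g := by
  have hspan : φ ∈ Submodule.span ℝ (range (integralInner (μ := μ) (n := n))) :=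
    (LinearMap.mem_span_iff_continuous φ).2 hφ
  clear hφ
  induction hspan using Submodule.span_induction with
  | mem φ h => exact ⟨h.choose, h.choose_spec.symm⟩
  | zero =>
    refine ⟨0, LinearMap.ext fun f => ?_⟩
    refine (integral_eq_zero_of_ae ?_).symm
    filter_upwards [Lp.coeFn_zero (EuclideanSpace ℝ (Fin n)) 1 μ] with ω hω
    rw [hω, Pi.zero_apply, inner_zero_left, Pi.zero_apply]
  | add φ ψ _ _ h h' =>
    obtain ⟨g, rfl⟩ := h
    obtain ⟨g', rfl⟩ := h'
    refine ⟨g + g', LinearMap.ext fun f => ?_⟩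
    refine (integral_add (integrable_inner_Lp g f) (integrable_inner_Lp g' f)).symm.trans ?_
    refine integral_congr_ae ?_
    filter_upwards [Lp.coeFn_add g g'] with ω hω
    rw [hω, Pi.add_apply, inner_add_left]
  | smul r φ _ h =>
    obtain ⟨g, rfl⟩ := h
    refine ⟨r • g, LinearMap.ext fun f => ?_⟩
    refine (integral_const_mul r _).symm.trans ?_
    refine integral_congr_ae ?_
    filter_upwards [Lp.coeFn_smul r g] with ω hω
    simp [hω, inner_smul_left]

theorem locallyNonconical_image_LinftyInto {F : Type*} [AddCommGroup F] [Module ℝ F]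
    [TopologicalSpace F] [IsTopologicalAddGroup F] [ContinuousSMul ℝ F] [T2Space F]
    [FiniteDimensional ℝ F] {K : Set (EuclideanSpace ℝ (Fin n))} (hc : IsCompact K)
    (hK : StrictConvex ℝ K) (T : Lp (EuclideanSpace ℝ (Fin n)) ∞ μ →ₗ[ℝ] F)
    (hT : Continuous[weakStarTopology μ n, inferInstance] T) :
    LocallyNonconical (T '' LinftyInto μ K) := by
  let e := (Module.finBasis ℝ F).equivFunL
  have hcoord : ∀ i, ∃ g, (LinearMap.proj i ∘ₗ e.toLinearEquiv.toLinearMap ∘ₗ T) =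
      integralInner (μ := μ) (n := n) g := fun i => by
    refine exists_integralInner_eq_of_continuous ?_
    have h1 : Continuous fun x => e x i := (continuous_apply i).comp e.continuous
    exact @Continuous.comp _ _ _ (weakStarTopology μ n) _ _ T (fun x => e x i) h1 hT
  choose g hg using hcoord
  refine LocallyNonconical.of_image_equiv e ?_
  have hval : ∀ f i, e (T f) i = ∫ ω, innerSL ℝ (g i ω) (f ω) ∂μ := fun f i =>
    LinearMap.congr_fun (hg i) f
  convert locallyNonconical_integrals_pi hc hK (μ := μ) (c := fun i ω => innerSL ℝ (g i ω))
    (fun i => (innerSL ℝ).continuous.comp_stronglyMeasurable (Lp.stronglyMeasurable (g i)))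
    (fun i => integrable_innerSL_Lp_one (g i)) using 1
  ext y
  constructor
  · rintro ⟨_, ⟨f, hf, rfl⟩, rfl⟩
    exact ⟨f, ⟨Lp.aestronglyMeasurable f, hf⟩, funext fun i => (hval f i).symm⟩
  · rintro ⟨f, hf, rfl⟩
    obtain ⟨R, hR⟩ := hc.isBounded.exists_norm_le
    have hmem : MemLp f ∞ μ := memLp_top_of_bound hf.1 R (hf.2.mono fun ω hω => hR _ hω)
    refine ⟨T hmem.toLp, ⟨hmem.toLp, ?_, rfl⟩, funext fun i => ?_⟩
    · filter_upwards [hmem.coeFn_toLp, hf.2] with ω h1 h2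
      rwa [h1]
    · rw [hval]
      refine integral_congr_ae ?_
      filter_upwards [hmem.coeFn_toLp] with ω h1
      rw [h1]

end WeakStar

/-! ### Extreme points and Lyapunov's theorem. -/

/-- A nonempty closed bounded convex set in a Hilbert space has an extreme point. -/
theorem extremePoints_nonempty_of_isClosed_of_isBounded {H : Type*} [NormedAddCommGroup H]
    [InnerProductSpace ℝ H] [CompleteSpace H] {C : Set H} (hcl : IsClosed C)
    (hb : Bornology.IsBounded C) (hconv : Convex ℝ C) (hne : C.Nonempty) :
    (C.extremePoints ℝ).Nonempty := by
  -- The Riesz isomorphism moves C to the weak dual, where Banach–Alaoglu and Krein–Milman apply.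
  let r : WeakDual ℝ H → H := fun φ => (InnerProductSpace.toDual ℝ H).symm (WeakDual.toStrongDual φ)
  have hr : ∀ φ x, inner ℝ (r φ) x = φ x := fun φ x => InnerProductSpace.toDual_symm_apply
  let d : H → WeakDual ℝ H := fun u => StrongDual.toWeakDual (InnerProductSpace.toDual ℝ H u)
  have hd : ∀ u x, d u x = inner ℝ u x := fun u x => rfl
  have hrd : ∀ u, r (d u) = u := fun u => (InnerProductSpace.toDual ℝ H).symm_apply_apply u
  have hdr : ∀ φ, d (r φ) = φ := fun φ => (InnerProductSpace.toDual ℝ H).apply_symm_apply _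
  -- A point outside C is strictly separated from it by an evaluation, which is weak* continuous.
  have hclosed : IsClosed (r ⁻¹' C) := by
    refine isOpen_compl_iff.1 (isOpen_iff_mem_nhds.2 fun φ hφ => ?_)
    obtain ⟨ℓ, s, hℓ, hℓC⟩ := geometric_hahn_banach_point_closed hconv hcl hφ
    obtain ⟨w, rfl⟩ := (InnerProductSpace.toDual ℝ H).surjective ℓ
    simp only [InnerProductSpace.toDual_apply_apply] at hℓ hℓC
    rw [real_inner_comm, hr] at hℓ
    filter_upwards [((WeakDual.eval_continuous w).continuousAt (x := φ)).eventually_lt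
      continuousAt_const hℓ] with ψ hψ hψC
    have := hℓC _ hψC
    rw [real_inner_comm, hr] at this
    exact lt_asymm hψ this
  have hbdd : Bornology.IsBounded (r ⁻¹' C) := by
    obtain ⟨R, hR⟩ := hb.exists_norm_le
    rw [← WeakDual.isBounded_toWeakDual_preimage_iff_isBounded, isBounded_iff_forall_norm_le]
    refine ⟨R, fun φ hφ => ?_⟩
    have := hR _ hφ
    rwa [LinearIsometryEquiv.norm_map] at this
  have : LocallyConvexSpace ℝ (WeakDual ℝ H) := (WeakDual.withSeminorms ℝ H).toLocallyConvexSpace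
  obtain ⟨φ, hφ⟩ := (WeakDual.isCompact_of_bounded_of_closed hbdd hclosed).extremePoints_nonempty
    ⟨d hne.some, by rw [mem_preimage, hrd]; exact hne.some_mem⟩
  rw [mem_extremePoints] at hφ
  refine ⟨r φ, mem_extremePoints.2 ⟨hφ.1, fun x hx y hy hxy => ?_⟩⟩
  obtain ⟨a, b, ha, hb, hab, habφ⟩ := hxy
  have hseg : a • d x + b • d y = φ := by
    rw [← hdr φ, ← habφ]
    refine DFunLike.ext _ _ fun z => ?_
    rw [hd, inner_add_left, inner_smul_left, inner_smul_left]
    rfl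
  obtain ⟨h1, h2⟩ := hφ.2 (d x) (by rwa [mem_preimage, hrd]) (d y) (by rwa [mem_preimage, hrd])
    ⟨a, b, ha, hb, hab, hseg⟩
  exact ⟨by rw [← h1, hrd], by rw [← h2, hrd]⟩

section Lyapunov

variable {Ω ι : Type*} [MeasurableSpace Ω] {μ : Measure Ω}

/-- Every set of positive measure contains infinitely many disjoint sets of positive measure, if it
can be split. -/
theorem exists_seq_disjoint_of_forall_split
    (hna : ∀ A, MeasurableSet A → μ A ≠ 0 →
      ∃ B ⊆ A, MeasurableSet B ∧ μ B ≠ 0 ∧ μ (A \ B) ≠ 0)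
    {A : Set Ω} (hA : MeasurableSet A) (hμA : μ A ≠ 0) :
    ∃ s : ℕ → Set Ω, Pairwise (Function.onFun Disjoint s) ∧
      ∀ k, s k ⊆ A ∧ MeasurableSet (s k) ∧ μ (s k) ≠ 0 := by
  choose! b hbA hbm hb hdiff using hna
  let D : ℕ → Set Ω := fun k => Nat.rec A (fun _ D => D \ b D) k
  have hD : ∀ k, MeasurableSet (D k) ∧ μ (D k) ≠ 0 := fun k => by
    induction k with
    | zero => exact ⟨hA, hμA⟩
    | succ k ih => exact ⟨ih.1.diff (hbm _ ih.1 ih.2), hdiff _ ih.1 ih.2⟩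
  have hanti : Antitone D := antitone_nat_of_succ_le fun k => sdiff_subset
  have hsub : ∀ k, b (D k) ⊆ D k := fun k => hbA _ (hD k).1 (hD k).2
  refine ⟨fun k => b (D k), ?_, fun k => ⟨(hsub k).trans (hanti (Nat.zero_le k)),
    hbm _ (hD k).1 (hD k).2, hb _ (hD k).1 (hD k).2⟩⟩
  refine (pairwise_disjoint_on _).2 fun m n hmn => ?_
  exact disjoint_sdiff_right.mono_right ((hsub n).trans (hanti (Nat.succ_le_of_lt hmn)))

/-- On a nonatomic set of positive measure there is a nonzero bounded function which is orthogonal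
to finitely many given integrable functions. -/
theorem exists_bounded_orthogonal_of_forall_split [Fintype ι] [IsFiniteMeasure μ]
    (hna : ∀ A, MeasurableSet A → μ A ≠ 0 →
      ∃ B ⊆ A, MeasurableSet B ∧ μ B ≠ 0 ∧ μ (A \ B) ≠ 0)
    {g : ι → Ω → ℝ} (hg : ∀ i, Integrable (g i) μ)
    {A : Set Ω} (hA : MeasurableSet A) (hμA : μ A ≠ 0) :
    ∃ (h : Ω → ℝ) (M : ℝ), Measurable h ∧ (∀ ω, |h ω| ≤ M) ∧ (∀ ω ∉ A, h ω = 0) ∧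
      (∀ i, ∫ ω, g i ω * h ω ∂μ = 0) ∧ ¬ h =ᵐ[μ] 0 := by
  obtain ⟨s, hdisj, hs⟩ := exists_seq_disjoint_of_forall_split hna hA hμA
  let v : Fin (Fintype.card ι + 1) → ι → ℝ := fun j i => ∫ ω in s j, g i ω ∂μ
  -- These are `card ι + 1` vectors in a space of dimension `card ι`; a linear relation gives the
  -- coefficients of the step function h.
  have hdep : ¬ LinearIndependent ℝ v := fun hli => by
    have := hli.fintype_card_le_finrank
    simp at this
  obtain ⟨c, hc0, j₀, hj₀⟩ := Fintype.not_linearIndependent_iff.1 hdep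
  let h : Ω → ℝ := fun ω => ∑ j : Fin (Fintype.card ι + 1), (s j).indicator (fun _ => c j) ω
  refine ⟨h, ∑ j, |c j|, ?_, fun ω => ?_, fun ω hω => ?_, fun i => ?_, fun h0 => ?_⟩
  · exact Finset.measurable_fun_sum _ fun j _ => measurable_const.indicator (hs j).2.1
  · refine (Finset.abs_sum_le_sum_abs _ _).trans (Finset.sum_le_sum fun j _ => ?_)
    by_cases hω : ω ∈ s j <;> simp [hω]
  · exact Finset.sum_eq_zero fun j _ => indicator_of_notMem (fun hj => hω ((hs j).1 hj)) _
  · have h1 : ∀ ω, g i ω * h ω = ∑ j : Fin (Fintype.card ι + 1),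
        (s j).indicator (fun ω => c j * g i ω) ω := fun ω => by
      rw [Finset.mul_sum]
      refine Finset.sum_congr rfl fun j _ => ?_
      by_cases hω : ω ∈ s j <;> simp [hω, mul_comm]
    simp only [h1]
    rw [integral_finsetSum _ fun j _ => ((hg i).const_mul (c j)).indicator (hs j).2.1]
    have h2 := congrFun hc0 i
    rw [Finset.sum_apply] at h2
    rw [Pi.zero_apply] at h2
    rw [← h2]
    refine Finset.sum_congr rfl fun j _ => ?_
    rw [integral_indicator (hs j).2.1, integral_const_mul]
    rfl
  · refine (hs j₀).2.2 (measure_mono_null (fun ω hω => ?_) (ae_iff.1 h0))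
    have : h ω = c j₀ := by
      refine (Finset.sum_eq_single j₀ (fun j _ hj => indicator_of_notMem (fun hjω => ?_) _)
        (by simp)).trans (indicator_of_mem hω _)
      exact (disjoint_left.1 (hdisj (fun h => hj (Fin.ext h)))) hjω hω
    simpa [this] using hj₀

theorem inner_toLp_two [IsFiniteMeasure μ] {g : Ω → ℝ} (hg : MemLp g 2 μ) (u : Lp ℝ 2 μ) :
    inner ℝ hg.toLp u = ∫ ω, g ω * u ω ∂μ := by
  rw [L2.inner_def]
  refine integral_congr_ae ?_
  filter_upwards [hg.coeFn_toLp] with ω hω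
  rw [hω]
  simp [mul_comm]

/-- **Lyapunov's theorem**: for a nonatomic measure, the integrals of finitely many functions
against a function with values in `[0, 1]` are the integrals over some set. -/
theorem exists_setIntegral_eq_of_forall_split [Fintype ι] [IsFiniteMeasure μ]
    (hna : ∀ A, MeasurableSet A → μ A ≠ 0 →
      ∃ B ⊆ A, MeasurableSet B ∧ μ B ≠ 0 ∧ μ (A \ B) ≠ 0)
    {g : ι → Ω → ℝ} (hg : ∀ i, MemLp (g i) 2 μ) {f : Ω → ℝ}
    (hf : f ∈ measurableSelections μ (Icc (0 : ℝ) 1)) :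
    ∃ B, MeasurableSet B ∧ ∀ i, ∫ ω in B, g i ω ∂μ = ∫ ω, g i ω * f ω ∂μ := by
  let C : Set (Lp ℝ 2 μ) := Icc 0 (Lp.const 2 μ (1 : ℝ)) ∩
    {u | ∀ i, inner ℝ (hg i).toLp u = ∫ ω, g i ω * f ω ∂μ}
  have hCiff : ∀ u : Lp ℝ 2 μ, u ∈ Icc 0 (Lp.const 2 μ (1 : ℝ)) ↔ ∀ᵐ ω ∂μ, u ω ∈ Icc (0 : ℝ) 1 := by
    intro u
    rw [mem_Icc, ← Lp.coeFn_le, ← Lp.coeFn_le]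
    constructor
    · rintro ⟨h0, h1⟩
      filter_upwards [h0, h1, Lp.coeFn_zero ℝ 2 μ, Lp.coeFn_const 2 μ (1 : ℝ)] with ω a b c d
      rw [c] at a
      rw [d] at b
      exact ⟨a, b⟩
    · intro h
      constructor
      · filter_upwards [h, Lp.coeFn_zero ℝ 2 μ] with ω a c
        rw [c]
        exact a.1
      · filter_upwards [h, Lp.coeFn_const 2 μ (1 : ℝ)] with ω a c
        rw [c]
        exact a.2
  have hcl : IsClosed C := by
    refine isClosed_Icc.inter ?_
    simp only [ofPred_forall]
    exact isClosed_iInter fun i => isClosed_eq (by fun_prop) continuous_const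
  have hconv : Convex ℝ C := by
    refine Convex.inter (fun u hu u' hu' a b ha hb hab => ?_) fun u hu u' hu' a b ha hb hab i => ?_
    · rw [hCiff] at *
      filter_upwards [hu, hu', Lp.coeFn_add (a • u) (b • u'), Lp.coeFn_smul a u,
        Lp.coeFn_smul b u'] with ω h1 h2 h3 h4 h5
      rw [h3, Pi.add_apply, h4, h5]
      exact convex_Icc 0 1 h1 h2 ha hb hab
    · rw [inner_add_right, inner_smul_right, inner_smul_right, hu i, hu' i, ← add_mul, hab, one_mul]
  have hbdd : Bornology.IsBounded C := by
    refine isBounded_iff_forall_norm_le.2 ⟨‖Lp.const 2 μ (1 : ℝ)‖, fun u hu => ?_⟩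
    refine norm_le_norm_of_abs_le_abs ?_
    rw [abs_of_nonneg hu.1.1, abs_of_nonneg (hu.1.1.trans hu.1.2)]
    exact hu.1.2
  have hfm : MemLp f 2 μ := MemLp.of_bound hf.1 1 (hf.2.mono fun ω hω => by
    rw [Real.norm_of_nonneg hω.1]
    exact hω.2)
  have hne : C.Nonempty := by
    refine ⟨hfm.toLp, (hCiff _).2 ?_, fun i => ?_⟩
    · filter_upwards [hfm.coeFn_toLp, hf.2] with ω h1 h2
      rwa [h1]
    · rw [inner_toLp_two]
      refine integral_congr_ae ?_
      filter_upwards [hfm.coeFn_toLp] with ω h1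
      rw [h1]
  obtain ⟨u, hu⟩ := extremePoints_nonempty_of_isClosed_of_isBounded hcl hbdd hconv hne
  rw [mem_extremePoints] at hu
  obtain ⟨huC, hext⟩ := hu
  have huI := (hCiff u).1 huC.1
  have hum : Measurable u := (Lp.stronglyMeasurable u).measurable
  -- An extreme point of C is an indicator: otherwise u stays in [1/(k+1), 1 - 1/(k+1)] on a set of
  -- positive measure, and small multiples ±δh of an orthogonal function supported there keep u ± δh
  -- in C.
  have h01 : μ (u ⁻¹' Ioo 0 1) = 0 := by
    have hcover : u ⁻¹' Ioo (0 : ℝ) 1 ⊆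
        ⋃ k : ℕ, u ⁻¹' Icc (1 / ((k : ℝ) + 1)) (1 - 1 / ((k : ℝ) + 1)) := by
      intro ω hω
      obtain ⟨k, hk⟩ := exists_nat_one_div_lt (lt_min hω.1 (sub_pos.2 hω.2))
      refine mem_iUnion.2 ⟨k, ?_, ?_⟩
      · exact (hk.trans_le (min_le_left _ _)).le
      · linarith [hk.trans_le (min_le_right _ _)]
    refine measure_mono_null hcover (measure_iUnion_null fun k => ?_)
    by_contra hpos
    obtain ⟨h, M, hhm, hhM, hhA, hhg, hh0⟩ := exists_bounded_orthogonal_of_forall_split hna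
      (fun i => (hg i).integrable one_le_two) (hum measurableSet_Icc) hpos
    have hM : 0 ≤ M := by
      by_contra hneg
      exact hh0 (Eventually.of_forall fun ω => absurd ((abs_nonneg _).trans (hhM ω)) hneg)
    -- This ensures |δh| ≤ 1/(k+1); the denominator M + 1 is positive even if M = 0.
    set δ : ℝ := 1 / ((k : ℝ) + 1) / (M + 1) with hδdef
    have hk : (0 : ℝ) < 1 / ((k : ℝ) + 1) := by positivity
    have hδ : 0 < δ := by positivity
    have hδM : ∀ ω, |δ * h ω| ≤ 1 / ((k : ℝ) + 1) := fun ω => by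
      rw [abs_mul, abs_of_pos hδ, hδdef, div_mul_eq_mul_div, div_le_iff₀ (by positivity)]
      gcongr
      linarith [hhM ω]
    have hhL : MemLp h 2 μ := MemLp.of_bound hhm.aestronglyMeasurable M
      (Eventually.of_forall hhM)
    have hmem : ∀ σ : ℝ, |σ| = δ → u + σ • hhL.toLp ∈ C := fun σ hσ => by
      refine ⟨(hCiff _).2 ?_, fun i => ?_⟩
      · filter_upwards [huI, Lp.coeFn_add u (σ • hhL.toLp), Lp.coeFn_smul σ hhL.toLp,
          hhL.coeFn_toLp] with ω h1 h2 h3 h4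
        rw [h2, Pi.add_apply, h3, Pi.smul_apply, h4, smul_eq_mul]
        by_cases hω : ω ∈ u ⁻¹' Icc (1 / ((k : ℝ) + 1)) (1 - 1 / ((k : ℝ) + 1))
        · have h5 := hδM ω
          rw [abs_mul, abs_of_pos hδ, ← hσ, ← abs_mul, abs_le] at h5
          exact ⟨by linarith [hω.1, h5.1], by linarith [hω.2, h5.2]⟩
        · rw [hhA ω hω, mul_zero, add_zero]
          exact h1
      · have h0 : inner ℝ (hg i).toLp hhL.toLp = (0 : ℝ) := by
          rw [inner_toLp_two, ← hhg i]
          refine integral_congr_ae ?_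
          filter_upwards [hhL.coeFn_toLp] with ω h1
          rw [h1]
        rw [inner_add_right, inner_smul_right, h0, mul_zero, add_zero]
        exact huC.2 i
    have hseg : u ∈ openSegment ℝ (u + δ • hhL.toLp) (u + (-δ) • hhL.toLp) := by
      refine ⟨1 / 2, 1 / 2, by norm_num, by norm_num, by norm_num, ?_⟩
      module
    have heq := (hext _ (hmem δ (abs_of_pos hδ)) _ (hmem (-δ) (by rw [abs_neg, abs_of_pos hδ]))
      hseg).1
    have hz : hhL.toLp = 0 := (smul_eq_zero.1 (add_eq_left.1 heq)).resolve_left hδ.ne'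
    refine hh0 ?_
    filter_upwards [hhL.coeFn_toLp, Lp.coeFn_zero ℝ 2 μ] with ω h1 h2
    rw [← h1, hz, h2]
  refine ⟨u ⁻¹' {1}, hum (measurableSet_singleton 1), fun i => ?_⟩
  rw [← huC.2 i, inner_toLp_two, ← integral_indicator (hum (measurableSet_singleton 1))]
  refine integral_congr_ae ?_
  have h01' : ∀ᵐ ω ∂μ, ω ∉ u ⁻¹' Ioo 0 1 := measure_eq_zero_iff_ae_notMem.1 h01
  filter_upwards [huI, h01'] with ω h1 h2
  by_cases hω : u ω = 1
  · rw [indicator_of_mem (by exact hω), hω, mul_one]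
  · have h0 : u ω = 0 := by
      by_contra h0
      exact h2 ⟨lt_of_le_of_ne h1.1 (Ne.symm h0), lt_of_le_of_ne h1.2 hω⟩
    rw [indicator_of_notMem (by exact hω), h0, mul_zero]

end Lyapunov

/-! ### Nonatomic vector measures. -/

section VectorMeasure

variable {Ω : Type*} [MeasurableSpace Ω]

/-- One of the two pieces of A in a Hahn decomposition has nonzero signed measure. -/
theorem SignedMeasure.exists_subset_ne_zero_of_totalVariation_ne_zero {s : SignedMeasure Ω}
    {A : Set Ω} (hA : MeasurableSet A) (h : s.totalVariation A ≠ 0) :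
    ∃ B ⊆ A, MeasurableSet B ∧ s B ≠ 0 := by
  by_contra! hB
  obtain ⟨P, hP, hP0, hP1, hpos, hneg⟩ := s.toJordanDecomposition_spec
  refine h ?_
  rw [SignedMeasure.totalVariation, Measure.add_apply, hpos, hneg,
    SignedMeasure.toMeasureOfZeroLE_apply _ _ hP hA,
    SignedMeasure.toMeasureOfLEZero_apply _ _ hP.compl hA]
  simp [hB _ inter_subset_right (hP.inter hA), hB _ inter_subset_right (hP.compl.inter hA)]

/-- A finite signed measure has a bounded density with respect to every finite measure which
dominates its total variation. -/
theorem SignedMeasure.exists_bounded_density {s : SignedMeasure Ω} {μ : Measure Ω}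
    [IsFiniteMeasure μ] (hs : s.totalVariation ≤ μ) :
    ∃ g : Ω → ℝ, Measurable g ∧ (∀ᵐ ω ∂μ, ‖g ω‖ ≤ 1) ∧
      ∀ A, MeasurableSet A → s A = ∫ ω in A, g ω ∂μ := by
  set p := s.toJordanDecomposition.posPart
  set q := s.toJordanDecomposition.negPart
  have hp : p ≤ μ := le_trans (Measure.le_add_right le_rfl) hs
  have hq : q ≤ μ := le_trans (Measure.le_add_left le_rfl) hs
  refine ⟨fun ω => (p.rnDeriv μ ω).toReal - (q.rnDeriv μ ω).toReal, ?_, ?_, fun A hA => ?_⟩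
  · exact (Measure.measurable_rnDeriv p μ).ennreal_toReal.sub
      (Measure.measurable_rnDeriv q μ).ennreal_toReal
  · filter_upwards [Measure.rnDeriv_le_one_of_le hp, Measure.rnDeriv_le_one_of_le hq] with ω h1 h2
    have h1' := ENNReal.toReal_mono ENNReal.one_ne_top h1
    have h2' := ENNReal.toReal_mono ENNReal.one_ne_top h2
    rw [ENNReal.toReal_one] at h1' h2'
    have h3 : 0 ≤ (p.rnDeriv μ ω).toReal := ENNReal.toReal_nonneg
    have h4 : 0 ≤ (q.rnDeriv μ ω).toReal := ENNReal.toReal_nonneg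
    rw [Real.norm_eq_abs, abs_le]
    constructor <;> linarith
  · rw [integral_sub Measure.integrable_toReal_rnDeriv.restrict
        Measure.integrable_toReal_rnDeriv.restrict,
      Measure.setIntegral_toReal_rnDeriv (Measure.absolutelyContinuous_of_le hp),
      Measure.setIntegral_toReal_rnDeriv (Measure.absolutelyContinuous_of_le hq)]
    exact s.apply_eq_posPart_real_sub_negPart_real hA

/-- If the null sets of `μ` are the sets on which a nonatomic vector measure vanishes identically,
then every set of positive `μ`-measure splits into two such sets. -/
theorem IsNonatomic.exists_split {F : Type*} [AddCommGroup F] [TopologicalSpace F] [T2Space F]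
    {ν : VectorMeasure Ω F} (hν : IsNonatomic ν)
    {μ : Measure Ω} (hnull : ∀ A, MeasurableSet A → μ A = 0 → ν A = 0)
    (hpos : ∀ A, MeasurableSet A → μ A ≠ 0 → ∃ B ⊆ A, MeasurableSet B ∧ ν B ≠ 0)
    {A : Set Ω} (hA : MeasurableSet A) (hμA : μ A ≠ 0) :
    ∃ B ⊆ A, MeasurableSet B ∧ μ B ≠ 0 ∧ μ (A \ B) ≠ 0 := by
  by_contra! hsplit
  obtain ⟨B, hBA, hB, hνB⟩ := hpos A hA hμA
  -- If A did not split, B would be an atom: each D ⊆ B is null or has null complement in A.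
  refine hν B ⟨hB, hνB, fun D hDB hD => ?_⟩
  by_cases hμD : μ D = 0
  · exact Or.inl (hnull D hD hμD)
  · right
    have h1 : ν (B \ D) = 0 := hnull _ (hB.diff hD)
      (measure_mono_null (sdiff_subset_sdiff_left hBA) (hsplit D (hDB.trans hBA) hD hμD))
    have h2 := VectorMeasure.of_add_of_sdiff (v := ν) hD hB hDB
    rwa [h1, add_zero] at h2

/-- The range of a nonatomic vector measure with values in a finite-dimensional space is locally
nonconical. -/
theorem IsNonatomic.locallyNonconical_range {F : Type*} [AddCommGroup F] [Module ℝ F]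
    [TopologicalSpace F] [IsTopologicalAddGroup F] [ContinuousSMul ℝ F] [T2Space F]
    [FiniteDimensional ℝ F] {ν : VectorMeasure Ω F} (hν : IsNonatomic ν) :
    LocallyNonconical (vectorMeasureRange ν) := by
  let e := (Module.finBasis ℝ F).equivFunL
  let s : Fin (Module.finrank ℝ F) → SignedMeasure Ω := fun i =>
    ν.mapRange ((Pi.evalAddMonoidHom (fun _ => ℝ) i).comp (e : F →+ (_ → ℝ)))
      ((continuous_apply i).comp e.continuous)
  have hs : ∀ i A, s i A = e (ν A) i := fun i A => rfl
  -- This μ dominates every coordinate, and its null sets are those on all of whose measurable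
  -- subsets ν vanishes.
  let μ : Measure Ω := ∑ i, (s i).totalVariation
  have hle : ∀ i, (s i).totalVariation ≤ μ := fun i =>
    Finset.single_le_sum (f := fun i => (s i).totalVariation) (fun _ _ => Measure.zero_le _)
      (Finset.mem_univ i)
  choose g hgm hgb hg using fun i => SignedMeasure.exists_bounded_density (hle i)
  have hsplit := fun A hA hμA => hν.exists_split (μ := μ) (fun A hA h0 => ?_)
    (fun A hA h0 => ?_) (A := A) hA hμA
  rotate_left
  · refine e.injective (funext fun i => ?_)
    rw [← hs, map_zero, Pi.zero_apply]
    exact (s i).null_of_totalVariation_zero (le_antisymm ((hle i A).trans h0.le) zero_le)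
  · obtain ⟨i, hi⟩ : ∃ i, (s i).totalVariation A ≠ 0 := by
      by_contra! h
      exact h0 (by simp [μ, Measure.finsetSum_apply, h])
    obtain ⟨B, hBA, hB, hsB⟩ := SignedMeasure.exists_subset_ne_zero_of_totalVariation_ne_zero hA hi
    refine ⟨B, hBA, hB, fun hνB => hsB ?_⟩
    rw [hs, hνB, map_zero, Pi.zero_apply]
  refine LocallyNonconical.of_image_equiv e ?_
  let c : Fin (Module.finrank ℝ F) → Ω → ℝ →L[ℝ] ℝ := fun i ω =>
    ContinuousLinearMap.mul ℝ ℝ (g i ω)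
  have hgi : ∀ i, MemLp (g i) 2 μ := fun i => MemLp.of_bound (hgm i).aestronglyMeasurable 1 (hgb i)
  -- Indicators give one inclusion, Lyapunov's theorem the other.
  have hset : e '' vectorMeasureRange ν =
      (fun (f : Ω → ℝ) i => ∫ ω, c i ω (f ω) ∂μ) '' measurableSelections μ (Icc 0 1) := by
    ext y
    constructor
    · rintro ⟨_, ⟨A, hA, rfl⟩, rfl⟩
      refine ⟨A.indicator fun _ => 1, ⟨(measurable_const.indicator hA).aestronglyMeasurable,
        Eventually.of_forall fun ω => ?_⟩, funext fun i => ?_⟩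
      · by_cases hω : ω ∈ A <;> simp [hω]
      · rw [← hs, hg i A hA, ← integral_indicator hA]
        refine integral_congr_ae (Eventually.of_forall fun ω => ?_)
        by_cases hω : ω ∈ A <;> simp [hω, c]
    · rintro ⟨f, hf, rfl⟩
      obtain ⟨B, hB, hBf⟩ := exists_setIntegral_eq_of_forall_split hsplit hgi hf
      refine ⟨ν B, ⟨B, hB, rfl⟩, funext fun i => ?_⟩
      rw [← hs, hg i B hB, hBf i]
      rfl
  rw [hset]
  exact locallyNonconical_integrals_pi isCompact_Icc (strictConvex_Icc 0 1)
    (fun i => (ContinuousLinearMap.mul ℝ ℝ).continuous.comp_stronglyMeasurable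
      (hgm i).stronglyMeasurable)
    (fun i => (ContinuousLinearMap.mul ℝ ℝ).integrable_comp ((hgi i).integrable one_le_two))

end VectorMeasure

end

theorem corollary34 {F : Type*} [AddCommGroup F] [Module ℝ F] [TopologicalSpace F]
    [IsTopologicalAddGroup F] [ContinuousSMul ℝ F] [T2Space F] [FiniteDimensional ℝ F] :
    (∀ {Ω : Type*} [MeasurableSpace Ω] (ν : VectorMeasure Ω F),
      IsNonatomic ν → LocallyNonconical (vectorMeasureRange ν)) ∧
    (∀ {Ω : Type*} [MeasurableSpace Ω] (μ : Measure Ω) [SigmaFinite μ] (n : ℕ)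
      (K : Set (EuclideanSpace ℝ (Fin n))), IsCompact K → StrictConvex ℝ K →
      ∀ T : Lp (EuclideanSpace ℝ (Fin n)) ∞ μ →ₗ[ℝ] F,
        Continuous[weakStarTopology μ n, inferInstance] T →
        LocallyNonconical (T '' LinftyInto μ K)) := by
  exact ⟨fun ν hν => hν.locallyNonconical_range,
    fun μ _ n K hc hK T hT => locallyNonconical_image_LinftyInto hc hK T hT⟩
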